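/- Theorem 2.3. Let $U$ be a reflexive and separable (real) Banach space, $m\ge 1$, and let $\xi$ be an $m$-dimensional random vector on a probability space $(\Omega,\mathcal F,\mathbb P)$ with centered Gaussian distribution $\mathcal N(0,\Sigma)$. Let $\Sigma^{1/2}$ be a root of $\Sigma$, i.e. an $m\times m$ matrix with $\Sigma^{1/2}(\Sigma^{1/2})^{\top}=\Sigma$. Let $g\colon U\times\mathbb R^m\to\mathbb R$ be locally Lipschitzian and jointly convex in both variables, and let $\bar u\in U$ be such that $g(\bar u,0)<0$ and the set $M=\{z\in\mathbb R^m\mid g(\bar u,z)\le 0\}$ is bounded. Let $$\varphi(u):=\mathbb P(g(u,\xi)\le 0),\qquad e(u,v):=\mu_\eta\{r\ge 0\mid g(u,r\Sigma^{1/2}v)\le 0\}\qquad(u\in U,\ v\in\mathbb S^{m-1}),$$ where $\mu_\eta$ is the one-dimensional chi distribution with $m$ degrees of freedom and $\mathbb S^{m-1}$ is the Euclidean unit sphere of $\mathbb R^m$, and let $\mu_\zeta$ be the uniform distribution on $\mathbb S^{m-1}$. Then $\varphi$ and all functions $e(\cdot,v)$, $v\in\mathbb S^{m-1}$, are Lipschitzian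 on a common neighborhood of $\bar u$ with a common constant, and $$\partial^C\varphi(\bar u)=\int_{\mathbb S^{m-1}}\partial^C_u e(\bar u,v)\,d\mu_\zeta(v).$$ Here, for a function $f\colon U\to\mathbb R$ that is Lipschitzian near $\bar u$, $\partial^C f(\bar u)=\{x^*\in U^*\mid x^*(h)\le f^0(\bar u;h)\ \forall h\in U\}$ is the Clarke subdifferential, with $f^0(\bar u;h)=\limsup_{u'\to\bar u,\,t\downarrow 0}\frac{f(u'+th)-f(u')}{t}$, and $\partial^C_u e(\bar u,v)$ is the Clarke subdifferential of $e(\cdot,v)$ at $\bar u$. The integral is understood in the sense of Aumann: it is the set of all $x^*\in U^*$ for which there is a measurable selection $x^*_v\in\partial^C_u e(\bar u,v)$ (for $\mu_\zeta$-a.e. $v$), meaning that $v\mapsto x^*_v(h)$ is measurable and integrable for every $h\in U$, such that $x^*(h)=\int_{\mathbb S^{m-1}}x^*_v(h)\,d\mu_\zeta(v)$ for all $h\in U$. -/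

import Mathlib

open MeasureTheory ProbabilityTheory Filter Topology

noncomputable section

/-- The Clarke directional derivative
`f°(x; h) = limsup_{x' → x, t ↓ 0} (f (x' + t h) - f x') / t`.
The upper limit is taken in the extended reals, so that no boundedness is needed to make sense of
it; it is finite as soon as `f` is Lipschitz near `x`. -/
def clarkeDeriv {X : Type*} [NormedAddCommGroup X] [NormedSpace ℝ X]
    (f : X → ℝ) (x h : X) : EReal :=
  limsup (fun p : X × ℝ => (((f (p.1 + p.2 • h) - f p.1) / p.2 : ℝ) : EReal))
    (𝓝 x ×ˢ 𝓝[>] (0 : ℝ))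

/-- The Clarke subdifferential `∂ᶜf(x)`: all continuous linear functionals `x*` with
`⟨x*, h⟩ ≤ f°(x; h)` for every direction `h`. -/
def clarkeSubdifferential {X : Type*} [NormedAddCommGroup X] [NormedSpace ℝ X]
    (f : X → ℝ) (x : X) : Set (StrongDual ℝ X) :=
  {x' | ∀ h : X, ((x' h : ℝ) : EReal) ≤ clarkeDeriv f x h}

/-- The Aumann integral of a multifunction `S` with values in the subsets of a dual space: all
functionals `x*` for which there is a measurable selection `s` of `S` (almost everywhere) such that
`x*(h) = ∫ s_t(h) dμ(t)` for every `h`. -/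
def aumannIntegral {T : Type*} [MeasurableSpace T] {X : Type*} [NormedAddCommGroup X]
    [NormedSpace ℝ X] (μ : Measure T) (S : T → Set (StrongDual ℝ X)) : Set (StrongDual ℝ X) :=
  {x' | ∃ s : T → StrongDual ℝ X,
    (∀ h : X, Measurable fun t => s t h) ∧
    (∀ᵐ t ∂μ, s t ∈ S t) ∧
    (∀ h : X, Integrable (fun t => s t h) μ ∧ x' h = ∫ t, s t h ∂μ)}

/-- The unit sphere of the Euclidean space `ℝᵐ`. -/
abbrev UnitSphere (m : ℕ) : Type :=
  Metric.sphere (0 : EuclideanSpace ℝ (Fin m)) 1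

/-- The uniform distribution on the unit sphere of `ℝᵐ`: normalized surface measure. -/
def uniformSphere (m : ℕ) : Measure (UnitSphere m) :=
  ((volume : Measure (EuclideanSpace ℝ (Fin m))).toSphere Set.univ)⁻¹ •
    (volume : Measure (EuclideanSpace ℝ (Fin m))).toSphere

/-- The density `2 ^ (1 - m / 2) / Γ(m / 2) * r ^ (m - 1) * exp (- r ^ 2 / 2)` on `(0, ∞)` of the
chi distribution with `m` degrees of freedom. -/
def chiDensity (m : ℕ) (r : ℝ) : ℝ :=
  (2 : ℝ) ^ (1 - (m : ℝ) / 2) / Real.Gamma ((m : ℝ) / 2) * r ^ (m - 1) * Real.exp (-r ^ 2 / 2)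

/-- The one-dimensional chi distribution with `m ≥ 1` degrees of freedom. -/
def chiMeasure (m : ℕ) : Measure ℝ :=
  ((volume : Measure ℝ).restrict (Set.Ioi 0)).withDensity fun r => ENNReal.ofReal (chiDensity m r)

/-- The probability function `φ(u) = P(g(u, ξ) ≤ 0)`. -/
def probFun {U Ω : Type*} [MeasurableSpace Ω] {m : ℕ} (P : Measure Ω)
    (ξ : Ω → EuclideanSpace ℝ (Fin m)) (g : U → EuclideanSpace ℝ (Fin m) → ℝ) (u : U) : ℝ :=
  P.real {ω | g u (ξ ω) ≤ 0}

/-- The radial probability function `e(u, v) = μ_η {r ≥ 0 | g(u, r A v) ≤ 0}`, where `A` is a root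
of the covariance matrix and `μ_η` is the chi distribution with `m` degrees of freedom. -/
def radialProbFun {U : Type*} {m : ℕ} (A : Matrix (Fin m) (Fin m) ℝ)
    (g : U → EuclideanSpace ℝ (Fin m) → ℝ) (u : U) (v : UnitSphere m) : ℝ :=
  (chiMeasure m).real
    {r : ℝ | 0 ≤ r ∧
      g u (r • Matrix.toEuclideanCLM (𝕜 := ℝ) A (v : EuclideanSpace ℝ (Fin m))) ≤ 0}

end

/-!
The spheric-radial decomposition of the Gaussian law gives `φ(u) = ∫ e(u, v) dμ_ζ(v)`. By joint
convexity the radii admissible for `(u, v)` form an interval starting at `0`. If the ray in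
direction `v` stays feasible at `ū`, it does so near `ū` and `e(·, v)` is locally constant;
otherwise `e(·, v)` is the chi distribution function composed with a concave radius function. In
both cases `-e(·, v)` is Clarke regular at `ū`, and dominated convergence shows that the Clarke
derivative of `φ` is the integral of those of `e(·, v)`. So `∂ᶜφ(ū)` consists of the functionals
dominated by an integral of sublinear functionals, and Strassen's disintegration theorem splits
them measurably.

The common Lipschitz constant comes from comparing radii: if `g(·, 0) ≤ 0` on the ball of radius `ε`
about `u'`, convexity makes `ε / (ε + ‖u - u'‖) * r` admissible at `u'` whenever `r` is at `u`.
-/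

/-- A left directional derivative realizing the Clarke derivative: the left difference quotients of
`f` at `x` in direction `h` converge to `p`, and `p` dominates `f°(x; h)`; the latter is written
out with real-valued quotients. This is Clarke regularity of `-f` at `x`, in direction `-h`. -/
structure HasClarkeLeftDeriv {X : Type*} [NormedAddCommGroup X] [NormedSpace ℝ X]
    (f : X → ℝ) (x h : X) (p : ℝ) : Prop where
  tendsto : Tendsto (fun s : ℝ => (f x - f (x - s • h)) / s) (𝓝[>] 0) (𝓝 p)
  eventually_le : ∀ c > p, ∀ᶠ q : X × ℝ in 𝓝 x ×ˢ 𝓝[>] (0 : ℝ),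
    (f (q.1 + q.2 • h) - f q.1) / q.2 ≤ c

section DifferenceQuotients

variable {X : Type*} [NormedAddCommGroup X] [NormedSpace ℝ X]

theorem tendsto_sub_smul_nhdsGT (x h : X) :
    Tendsto (fun s : ℝ => x - s • h) (𝓝[>] 0) (𝓝 x) := by
  have hcont : Continuous fun s : ℝ => x - s • h := by fun_prop
  simpa using (hcont.tendsto 0).mono_left nhdsWithin_le_nhds

theorem tendsto_add_smul_prod_nhdsGT (x h : X) :
    Tendsto (fun q : X × ℝ => q.1 + q.2 • h) (𝓝 x ×ˢ 𝓝[>] (0 : ℝ)) (𝓝 x) := by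
  have hcont : Continuous fun q : X × ℝ => q.1 + q.2 • h := by fun_prop
  have hlim := hcont.tendsto (x, 0)
  simp only [zero_smul, add_zero, nhds_prod_eq] at hlim
  exact hlim.mono_left (Filter.prod_mono le_rfl nhdsWithin_le_nhds)

theorem tendsto_sub_smul_prodMk (x h : X) :
    Tendsto (fun s : ℝ => (x - s • h, s)) (𝓝[>] 0) (𝓝 x ×ˢ 𝓝[>] (0 : ℝ)) :=
  (tendsto_sub_smul_nhdsGT x h).prodMk tendsto_id

theorem abs_sub_div_le_of_lipschitzOnWith {K : NNReal} {f : X → ℝ} {N : Set X}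
    (hf : LipschitzOnWith K f N) {a b h : X} (ha : a ∈ N) (hb : b ∈ N) {s : ℝ} (hs : 0 < s)
    (hab : a - b = s • h) : |(f a - f b) / s| ≤ K * ‖h‖ := by
  have hdist := hf.dist_le_mul a ha b hb
  rw [Real.dist_eq, dist_eq_norm, hab, norm_smul, Real.norm_eq_abs, abs_of_pos hs] at hdist
  rw [abs_div, abs_of_pos hs, div_le_iff₀ hs]
  linarith

end DifferenceQuotients

namespace HasClarkeLeftDeriv

section Basic

variable {X : Type*} [NormedAddCommGroup X] [NormedSpace ℝ X] {f : X → ℝ} {x h k : X}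
  {p q r : ℝ}

theorem clarkeDeriv_eq (hp : HasClarkeLeftDeriv f x h p) : clarkeDeriv f x h = (p : EReal) := by
  refine le_antisymm (EReal.le_of_forall_lt_iff_le.1 fun z hz => ?_) ?_
  · refine limsup_le_of_le (by isBoundedDefault) ?_
    filter_upwards [hp.eventually_le z (by exact_mod_cast hz)] with q hq
    exact_mod_cast hq
  · have hleft : Tendsto (fun s : ℝ => (((f x - f (x - s • h)) / s : ℝ) : EReal)) (𝓝[>] 0)
        (𝓝 (p : EReal)) := (continuous_coe_real_ereal.tendsto p).comp hp.tendsto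
    have hle := limsup_le_limsup_of_le (tendsto_sub_smul_prodMk x h)
      (u := fun p : X × ℝ => (((f (p.1 + p.2 • h) - f p.1) / p.2 : ℝ) : EReal))
    rw [← hleft.limsup_eq]
    refine le_trans (le_of_eq ?_) hle
    simp only [limsup, Filter.map_map, Function.comp_def, sub_add_cancel]

theorem clarkeSubdifferential_eq {p : X → ℝ} (hp : ∀ h, HasClarkeLeftDeriv f x h (p h)) :
    clarkeSubdifferential f x = {x' | ∀ h, x' h ≤ p h} := by
  simp only [clarkeSubdifferential, (hp _).clarkeDeriv_eq, EReal.coe_le_coe_iff]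

theorem le_add (hh : HasClarkeLeftDeriv f x h p) (hk : HasClarkeLeftDeriv f x k q)
    (hhk : HasClarkeLeftDeriv f x (h + k) r) : r ≤ p + q := by
  refine le_of_forall_pos_le_add fun ε hε => ?_
  rw [add_assoc]
  refine le_of_tendsto_of_tendsto hhk.tendsto (hh.tendsto.add_const (q + ε)) ?_
  filter_upwards [(tendsto_sub_smul_prodMk x (h + k)).eventually
    (hk.eventually_le (q + ε) (by linarith))] with s hs
  have hshift : x - s • (h + k) + s • k = x - s • h := by rw [smul_add]; abel
  rw [hshift] at hs
  calc (f x - f (x - s • (h + k))) / s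
      = (f x - f (x - s • h)) / s + (f (x - s • h) - f (x - s • (h + k))) / s := by ring
    _ ≤ (f x - f (x - s • h)) / s + (q + ε) := by gcongr

theorem smul_eq {c : ℝ} (hc : 0 < c) (hh : HasClarkeLeftDeriv f x h p)
    (hch : HasClarkeLeftDeriv f x (c • h) q) : q = c * p := by
  have hscale : Tendsto (fun s : ℝ => s * c) (𝓝[>] 0) (𝓝[>] 0) := by
    refine tendsto_nhdsWithin_iff.2 ⟨?_, ?_⟩
    · simpa using ((continuous_mul_const c).tendsto 0).mono_left nhdsWithin_le_nhds
    · filter_upwards [self_mem_nhdsWithin] with s hs using mul_pos hs hc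
  refine tendsto_nhds_unique hch.tendsto (((hh.tendsto.comp hscale).const_mul c).congr' ?_)
  filter_upwards [self_mem_nhdsWithin] with s (hs : 0 < s)
  simp only [Function.comp_apply, smul_smul]
  field_simp

theorem abs_le {K : NNReal} {N : Set X} (hN : N ∈ 𝓝 x) (hf : LipschitzOnWith K f N)
    (hh : HasClarkeLeftDeriv f x h p) : |p| ≤ K * ‖h‖ := by
  refine le_of_tendsto hh.tendsto.abs ?_
  filter_upwards [tendsto_sub_smul_nhdsGT x h hN, self_mem_nhdsWithin] with s hs (hs0 : 0 < s)
  exact abs_sub_div_le_of_lipschitzOnWith hf (mem_of_mem_nhds hN) hs hs0 (sub_sub_cancel _ _)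

theorem congr {g : X → ℝ} (hp : HasClarkeLeftDeriv f x h p) (hfg : f =ᶠ[𝓝 x] g) :
    HasClarkeLeftDeriv g x h p := by
  refine ⟨hp.tendsto.congr' ?_, fun c hc => ?_⟩
  · filter_upwards [(tendsto_sub_smul_nhdsGT x h).eventually hfg] with s hs
    rw [hs, hfg.self_of_nhds]
  · filter_upwards [hp.eventually_le c hc, (tendsto_add_smul_prod_nhdsGT x h).eventually hfg,
      tendsto_fst.eventually hfg] with q hle hadd hq
    rwa [← hadd, ← hq]

theorem const (c : ℝ) : HasClarkeLeftDeriv (fun _ : X => c) x h 0 :=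
  ⟨by simp, fun c hc => Eventually.of_forall fun _ => by simpa using hc.le⟩

end Basic

section Integral

variable {X : Type*} [NormedAddCommGroup X] [NormedSpace ℝ X] {x h : X}
  {T : Type*} [MeasurableSpace T] {μ : Measure T} {F : X → T → ℝ} {K : NNReal} {N : Set X}
  {p : T → ℝ}

theorem integrable [IsFiniteMeasure μ] (hF : ∀ u, Integrable (F u) μ) (hN : N ∈ 𝓝 x)
    (hLip : ∀ t, LipschitzOnWith K (fun u => F u t) N)
    (hp : ∀ t, HasClarkeLeftDeriv (fun u => F u t) x h (p t)) : Integrable p μ := by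
  have hmeas : AEStronglyMeasurable p μ :=
    aestronglyMeasurable_of_tendsto_ae (𝓝[>] (0 : ℝ))
      (fun s => (((hF x).sub (hF (x - s • h))).div_const s).1)
      (Eventually.of_forall fun t => (hp t).tendsto)
  exact Integrable.of_bound hmeas (K * ‖h‖)
    (Eventually.of_forall fun t => (hp t).abs_le hN (hLip t))

theorem tendsto_integral_posPart_sub [IsFiniteMeasure μ] (hF : ∀ u, Integrable (F u) μ)
    (hN : N ∈ 𝓝 x) (hLip : ∀ t, LipschitzOnWith K (fun u => F u t) N)
    (hp : ∀ t, HasClarkeLeftDeriv (fun u => F u t) x h (p t)) :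
    Tendsto (fun q : X × ℝ => ∫ t, max ((F (q.1 + q.2 • h) t - F q.1 t) / q.2 - p t) 0 ∂μ)
      (𝓝 x ×ˢ 𝓝[>] (0 : ℝ)) (𝓝 0) := by
  have hpint := integrable hF hN hLip hp
  have hzero : (0 : ℝ) = ∫ _, 0 ∂μ := by simp
  conv => arg 3; rw [hzero]
  refine tendsto_integral_filter_of_dominated_convergence (fun _ => K * ‖h‖ + K * ‖h‖)
    (Eventually.of_forall fun q =>
      ((((hF _).sub (hF _)).div_const _).sub hpint).pos_part.1) ?_
    (integrable_const _) (Eventually.of_forall fun t => ?_)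
  · filter_upwards [tendsto_add_smul_prod_nhdsGT x h hN, tendsto_fst hN,
      tendsto_snd self_mem_nhdsWithin] with q hadd hfst (hpos : 0 < q.2)
    refine Eventually.of_forall fun t => ?_
    have hquot :=
      abs_sub_div_le_of_lipschitzOnWith (hLip t) hadd hfst hpos (add_sub_cancel_left _ _)
    have hpt := (hp t).abs_le hN (hLip t)
    rw [Real.norm_eq_abs, abs_of_nonneg (le_max_right _ _)]
    exact max_le (by linarith [le_of_abs_le hquot, neg_le_of_abs_le hpt])
      (by linarith [abs_nonneg (p t)])
  · refine tendsto_order.2 ⟨fun a ha => Eventually.of_forall fun q => lt_max_of_lt_right ha,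
      fun a ha => ?_⟩
    filter_upwards [(hp t).eventually_le (p t + a / 2) (by linarith)] with q hq
    exact max_lt (by linarith) ha

theorem integral [IsFiniteMeasure μ] (hF : ∀ u, Integrable (F u) μ) (hN : N ∈ 𝓝 x)
    (hLip : ∀ t, LipschitzOnWith K (fun u => F u t) N)
    (hp : ∀ t, HasClarkeLeftDeriv (fun u => F u t) x h (p t)) :
    HasClarkeLeftDeriv (fun u => ∫ t, F u t ∂μ) x h (∫ t, p t ∂μ) := by
  have hquotInt : ∀ (a b : X) (s : ℝ), Integrable (fun t => (F a t - F b t) / s) μ :=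
    fun a b s => ((hF a).sub (hF b)).div_const s
  have hquotEq : ∀ (a b : X) (s : ℝ),
      (∫ t, F a t ∂μ - ∫ t, F b t ∂μ) / s = ∫ t, (F a t - F b t) / s ∂μ := fun a b s => by
    rw [integral_div, integral_sub (hF _) (hF _)]
  have hpint := integrable hF hN hLip hp
  refine ⟨?_, fun c hc => ?_⟩
  · simp_rw [hquotEq]
    refine tendsto_integral_filter_of_dominated_convergence (fun _ => K * ‖h‖)
      (Eventually.of_forall fun s => (hquotInt _ _ _).1) ?_ (integrable_const _)
      (Eventually.of_forall fun t => (hp t).tendsto)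
    filter_upwards [tendsto_sub_smul_nhdsGT x h hN, self_mem_nhdsWithin] with s hs hs0
    exact Eventually.of_forall fun t => abs_sub_div_le_of_lipschitzOnWith (hLip t)
      (mem_of_mem_nhds hN) hs hs0 (sub_sub_cancel _ _)
  · filter_upwards [(tendsto_integral_posPart_sub hF hN hLip hp).eventually
      (gt_mem_nhds (sub_pos.2 hc))] with q hq
    have hle : ∫ t, ((F (q.1 + q.2 • h) t - F q.1 t) / q.2 - p t) ∂μ ≤
        ∫ t, max ((F (q.1 + q.2 • h) t - F q.1 t) / q.2 - p t) 0 ∂μ :=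
      integral_mono ((hquotInt _ _ _).sub hpint) ((hquotInt _ _ _).sub hpint).pos_part
        fun t => le_max_left _ _
    rw [integral_sub (hquotInt _ _ _) hpint, ← hquotEq] at hle
    linarith

end Integral

end HasClarkeLeftDeriv

section Concave

variable {X : Type*} [NormedAddCommGroup X] [NormedSpace ℝ X] {S : Set X} {ρ : X → ℝ} {x h : X}

theorem concaveOn_line (hρ : ConcaveOn ℝ S ρ) (x h : X) :
    ConcaveOn ℝ {r : ℝ | x + r • h ∈ S} fun r => ρ (x + r • h) := by
  convert hρ.comp_affineMap (AffineMap.lineMap x (x + h)) using 1 <;>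
    ext <;> simp [AffineMap.lineMap_apply_module', add_comm]

theorem div_le_div_of_concaveOn (hρ : ConcaveOn ℝ S ρ) {s t : ℝ} (hs : 0 < s) (ht : 0 < t)
    (hxs : x - s • h ∈ S) (hxt : x + t • h ∈ S) :
    (ρ (x + t • h) - ρ x) / t ≤ (ρ x - ρ (x - s • h)) / s := by
  have hslope := (concaveOn_line hρ x h).slope_anti_adjacent (x := -s) (y := 0) (z := t)
    (by simpa [← sub_eq_add_neg] using hxs) hxt (by linarith) ht
  simpa [← sub_eq_add_neg] using hslope

theorem exists_tendsto_left_quotient (hS : IsOpen S) (hρ : ConcaveOn ℝ S ρ) (hx : x ∈ S) (h : X) :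
    ∃ p, Tendsto (fun s : ℝ => (ρ x - ρ (x - s • h)) / s) (𝓝[>] 0) (𝓝 p) := by
  have hline := concaveOn_line hρ x (-h)
  have hopen : IsOpen {r : ℝ | x + r • -h ∈ S} := hS.preimage (by fun_prop)
  have hzero : (0 : ℝ) ∈ interior {r : ℝ | x + r • -h ∈ S} := by
    rw [hopen.interior_eq]
    simpa using hx
  have hderiv := (hline.neg.differentiableWithinAt_Ioi_of_mem_interior hzero).hasDerivWithinAt
  refine ⟨_, ((hasDerivWithinAt_iff_tendsto_slope' Set.self_notMem_Ioi).1 hderiv).congr fun s => ?_⟩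
  simp only [slope_def_field, Pi.neg_apply, smul_neg, ← sub_eq_add_neg, zero_smul, sub_zero]
  ring

theorem exists_hasClarkeLeftDeriv_of_concaveOn (hS : IsOpen S) (hρ : ConcaveOn ℝ S ρ)
    (hcont : ContinuousOn ρ S) (hx : x ∈ S) (h : X) : ∃ p, HasClarkeLeftDeriv ρ x h p := by
  obtain ⟨p, hp⟩ := exists_tendsto_left_quotient hS hρ hx h
  refine ⟨p, hp, fun c hc => ?_⟩
  obtain ⟨s, hsc, hsS, hs⟩ := ((hp.eventually (gt_mem_nhds hc)).and
    (((tendsto_sub_smul_nhdsGT x h).eventually (hS.mem_nhds hx)).and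
      self_mem_nhdsWithin)).exists
  have hshift : ContinuousAt (fun u => u - s • h) x := by fun_prop
  have hquot : ContinuousAt (fun u => (ρ u - ρ (u - s • h)) / s) x :=
    ((hcont.continuousAt (hS.mem_nhds hx)).sub
      (ContinuousAt.comp (f := fun u => u - s • h) (hcont.continuousAt (hS.mem_nhds hsS))
        hshift)).div_const s
  filter_upwards [tendsto_fst.eventually (hquot.eventually (gt_mem_nhds hsc)),
    tendsto_fst.eventually (hshift.eventually (hS.mem_nhds hsS)),
    tendsto_add_smul_prod_nhdsGT x h (hS.mem_nhds hx),
    tendsto_snd self_mem_nhdsWithin] with q hqc hqs hqt (hq : 0 < q.2)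
  exact (div_le_div_of_concaveOn hρ hs hq hqs hqt).trans hqc.le

end Concave

namespace HasClarkeLeftDeriv

section Comp

variable {X : Type*} [NormedAddCommGroup X] [NormedSpace ℝ X] {ρ : X → ℝ} {x h : X} {p : ℝ}
  {K : NNReal} {N : Set X} {G : ℝ → ℝ} {G' : ℝ}

theorem tendsto_comp_quotient_sub (hN : N ∈ 𝓝 x) (hLip : LipschitzOnWith K ρ N)
    (hG : HasStrictDerivAt G G' (ρ x)) (h : X) :
    Tendsto (fun q : X × ℝ =>
      (G (ρ (q.1 + q.2 • h)) - G (ρ q.1)) / q.2 - G' * ((ρ (q.1 + q.2 • h) - ρ q.1) / q.2))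
      (𝓝 x ×ˢ 𝓝[>] (0 : ℝ)) (𝓝 0) := by
  have hcont : ContinuousAt ρ x := hLip.continuousOn.continuousAt hN
  have hpair : Tendsto (fun q : X × ℝ => (ρ (q.1 + q.2 • h), ρ q.1)) (𝓝 x ×ˢ 𝓝[>] (0 : ℝ))
      (𝓝 (ρ x, ρ x)) := by
    rw [nhds_prod_eq]
    exact (hcont.tendsto.comp (tendsto_add_smul_prod_nhdsGT x h)).prodMk
      (hcont.tendsto.comp tendsto_fst)
  have hbigO : (fun q : X × ℝ => ρ (q.1 + q.2 • h) - ρ q.1)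
      =O[𝓝 x ×ˢ 𝓝[>] (0 : ℝ)] fun q => q.2 := by
    refine Asymptotics.IsBigO.of_bound (K * ‖h‖) ?_
    filter_upwards [tendsto_add_smul_prod_nhdsGT x h hN, tendsto_fst hN] with q hadd hfst
    have hdist := hLip.norm_sub_le hadd hfst
    rwa [add_sub_cancel_left, norm_smul, mul_comm ‖q.2‖, ← mul_assoc] at hdist
  refine ((hG.hasStrictFDerivAt.isLittleO.comp_tendsto hpair).trans_isBigO
    hbigO).tendsto_div_nhds_zero.congr fun q => ?_
  simp only [Function.comp_apply, ContinuousLinearMap.toSpanSingleton_apply, smul_eq_mul]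
  ring

theorem comp (hN : N ∈ 𝓝 x) (hLip : LipschitzOnWith K ρ N) (hp : HasClarkeLeftDeriv ρ x h p)
    (hG : HasStrictDerivAt G G' (ρ x)) (hG' : 0 ≤ G') :
    HasClarkeLeftDeriv (fun u => G (ρ u)) x h (G' * p) := by
  have herr := tendsto_comp_quotient_sub hN hLip hG h
  refine ⟨?_, fun c hc => ?_⟩
  · have hsum := (herr.comp (tendsto_sub_smul_prodMk x h)).add (hp.tendsto.const_mul G')
    rw [zero_add] at hsum
    simpa only [Function.comp_apply, sub_add_cancel] using hsum
  · set η := (c - G' * p) / (G' + 1) with hη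
    have hη0 : 0 < η := div_pos (by linarith) (by linarith)
    have hηc : η + G' * (p + η) = c := by rw [hη]; field_simp; ring
    filter_upwards [herr.eventually (gt_mem_nhds hη0), hp.eventually_le (p + η) (by linarith)]
      with q hqerr hqle
    linarith [mul_le_mul_of_nonneg_left hqle hG']

end Comp

end HasClarkeLeftDeriv

theorem exists_hasClarkeLeftDeriv_comp_of_concaveOn {X : Type*} [NormedAddCommGroup X]
    [NormedSpace ℝ X] {ρ : X → ℝ} {x : X} {δ R : ℝ} (hδ : 0 < δ)
    (hρ : ConcaveOn ℝ (Metric.ball x δ) ρ) (hbound : ∀ u, dist u x < δ → |ρ u| ≤ R)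
    {G : ℝ → ℝ} {G' : ℝ} (hG : HasStrictDerivAt G G' (ρ x)) (hG' : 0 ≤ G') (h : X) :
    ∃ p, HasClarkeLeftDeriv (fun u => G (ρ u)) x h p := by
  have hLip := hρ.lipschitzOnWith_of_abs_le (half_pos hδ) hbound
  rw [sub_half] at hLip
  obtain ⟨p, hp⟩ := exists_hasClarkeLeftDeriv_of_concaveOn Metric.isOpen_ball
    (hρ.subset (Metric.ball_subset_ball (half_le_self hδ.le)) (convex_ball _ _))
    hLip.continuousOn (Metric.mem_ball_self (half_pos hδ)) h
  exact ⟨_, hp.comp (Metric.ball_mem_nhds x (half_pos hδ)) hLip hG hG'⟩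

/-- Sublinear functionals on a real vector space: subadditive and positively homogeneous. -/
structure IsSublinear {V : Type*} [AddCommGroup V] [Module ℝ V] (q : V → ℝ) : Prop where
  add_le : ∀ h k, q (h + k) ≤ q h + q k
  smul_eq : ∀ c : ℝ, 0 < c → ∀ h, q (c • h) = c * q h

namespace IsSublinear

theorem map_zero {V : Type*} [AddCommGroup V] [Module ℝ V] {q : V → ℝ} (hq : IsSublinear q) :
    q 0 = 0 := by
  have hdouble := hq.smul_eq 2 two_pos 0
  rw [smul_zero] at hdouble
  linarith

section Normed

variable {U : Type*} [NormedAddCommGroup U] [NormedSpace ℝ U] {q : U → ℝ} {K : NNReal}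

theorem abs_le (hq : IsSublinear q) (hK : ∀ h, q h ≤ K * ‖h‖) (h : U) : |q h| ≤ K * ‖h‖ := by
  have hneg := hq.add_le h (-h)
  have hKneg := hK (-h)
  rw [add_neg_cancel, hq.map_zero] at hneg
  rw [norm_neg] at hKneg
  exact _root_.abs_le.2 ⟨by linarith, hK h⟩

theorem lipschitzWith (hq : IsSublinear q) (hK : ∀ h, q h ≤ K * ‖h‖) : LipschitzWith K q := by
  refine LipschitzWith.of_le_add_mul K fun h k => ?_
  calc q h = q (k + (h - k)) := by rw [add_sub_cancel]
    _ ≤ q k + q (h - k) := hq.add_le _ _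
    _ ≤ q k + K * dist h k := by rw [dist_eq_norm]; gcongr; exact hK _

end Normed

/-- Hahn–Banach along a linear map `c` that need not be injective. -/
theorem exists_linearMap_comp_eq {V W : Type*} [AddCommGroup V] [Module ℝ V] [AddCommGroup W]
    [Module ℝ W] {N : W → ℝ} (hN : IsSublinear N) (c : V →ₗ[ℝ] W) (φ : V →ₗ[ℝ] ℝ)
    (hφ : ∀ v, φ v ≤ N (c v)) :
    ∃ Λ : W →ₗ[ℝ] ℝ, (∀ v, Λ (c v) = φ v) ∧ ∀ w, Λ w ≤ N w := by
  have hker : φ ∈ (LinearMap.ker c).dualAnnihilator := by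
    refine (Submodule.mem_dualAnnihilator φ).2 fun v (hv : c v = 0) => ?_
    have hpos := hφ v
    have hneg := hφ (-v)
    rw [_root_.map_neg, _root_.map_neg, hv, neg_zero, hN.map_zero] at hneg
    rw [hv, hN.map_zero] at hpos
    linarith
  rw [← LinearMap.range_dualMap_eq_dualAnnihilator_ker] at hker
  obtain ⟨ψ, rfl⟩ := hker
  obtain ⟨Λ, hΛ, hle⟩ := exists_extension_of_le_sublinear
    ⟨LinearMap.range c, ψ.domRestrict (LinearMap.range c)⟩ N hN.smul_eq hN.add_le
    (by rintro ⟨_, v, rfl⟩; exact hφ v)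
  exact ⟨Λ, fun v => hΛ ⟨c v, v, rfl⟩, hle⟩

end IsSublinear

theorem exists_density_of_additive_of_abs_le {T : Type*} [MeasurableSpace T] {μ : Measure T}
    [IsFiniteMeasure μ] (ν : Set T → ℝ) {C : NNReal} (hbd : ∀ B, |ν B| ≤ C * μ.real B)
    (hadd : ∀ B B', MeasurableSet B → MeasurableSet B' → Disjoint B B' → ν (B ∪ B') = ν B + ν B')
    (hmeas : ∀ B, ¬MeasurableSet B → ν B = 0) :
    ∃ y : T → ℝ, Measurable y ∧ Integrable y μ ∧
      ∀ B, MeasurableSet B → ∫ t in B, y t ∂μ = ν B := by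
  have hle : ∀ B, ‖ν B‖ₑ ≤ (C • μ) B := fun B => by
    rw [Measure.smul_apply, ← ofReal_norm, Real.norm_eq_abs]
    refine (ENNReal.ofReal_le_ofReal (hbd B)).trans_eq ?_
    rw [ENNReal.ofReal_mul C.coe_nonneg, ofReal_measureReal, ENNReal.ofReal_coe_nnreal,
      ENNReal.smul_def, smul_eq_mul]
  let σ : SignedMeasure T := VectorMeasure.of_additive_of_le_measure (μ := C • μ) ν hle hadd hmeas
  have hac : σ ≪ᵥ μ.toENNRealVectorMeasure := by
    refine VectorMeasure.AbsolutelyContinuous.mk fun B hB hzero => ?_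
    rw [Measure.toENNRealVectorMeasure_apply_measurable hB] at hzero
    have hνB := hbd B
    rw [measureReal_def, hzero, ENNReal.toReal_zero, mul_zero] at hνB
    exact abs_nonpos_iff.1 hνB
  refine ⟨σ.rnDeriv μ, SignedMeasure.measurable_rnDeriv _ _, SignedMeasure.integrable_rnDeriv _ _,
    fun B hB => ?_⟩
  rw [← withDensityᵥ_apply (SignedMeasure.integrable_rnDeriv σ μ) hB,
    SignedMeasure.withDensityᵥ_rnDeriv_eq σ μ hac]
  rfl

section IntegralOfSublinear

variable {T : Type*} [MeasurableSpace T] {μ : Measure T} {U : Type*}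
  [NormedAddCommGroup U] [NormedSpace ℝ U] {p : T → U → ℝ} {K : NNReal}

theorem integrable_sublinear_simpleFunc [IsFiniteMeasure μ] (hpm : ∀ h, Measurable fun t => p t h)
    (hp : ∀ t, IsSublinear (p t)) (hpK : ∀ t h, p t h ≤ K * ‖h‖) (g : SimpleFunc T U) :
    Integrable (fun t => p t (g t)) μ := by
  obtain ⟨C, hC⟩ := g.exists_forall_norm_le
  refine Integrable.of_bound (g.measurable_bind (fun h t => p t h) hpm).aestronglyMeasurable
    (K * C) (Eventually.of_forall fun t => ((hp t).abs_le (hpK t) (g t)).trans ?_)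
  gcongr
  exact hC t

theorem isSublinear_integral [IsFiniteMeasure μ] (hpm : ∀ h, Measurable fun t => p t h)
    (hp : ∀ t, IsSublinear (p t)) (hpK : ∀ t h, p t h ≤ K * ‖h‖) :
    IsSublinear fun g : SimpleFunc T U => ∫ t, p t (g t) ∂μ where
  add_le g g' := by
    have hint := integrable_sublinear_simpleFunc (μ := μ) hpm hp hpK
    rw [← integral_add (hint g) (hint g')]
    exact integral_mono (hint (g + g')) ((hint g).add (hint g')) fun t => (hp t).add_le _ _
  smul_eq c hc g := by
    rw [← integral_const_mul]
    exact integral_congr_ae (Eventually.of_forall fun t => (hp t).smul_eq c hc _)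

theorem exists_linearMap_simpleFunc_of_le_integral [IsFiniteMeasure μ]
    (hpm : ∀ h, Measurable fun t => p t h) (hp : ∀ t, IsSublinear (p t))
    (hpK : ∀ t h, p t h ≤ K * ‖h‖) (x' : U →ₗ[ℝ] ℝ) (hx' : ∀ h, x' h ≤ ∫ t, p t h ∂μ) :
    ∃ Λ : SimpleFunc T U →ₗ[ℝ] ℝ, (∀ h, Λ (SimpleFunc.const T h) = x' h) ∧
      ∀ g, Λ g ≤ ∫ t, p t (g t) ∂μ :=
  (isSublinear_integral hpm hp hpK).exists_linearMap_comp_eq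
    { toFun := SimpleFunc.const T, map_add' := fun _ _ => rfl, map_smul' := fun _ _ => rfl } x' hx'

theorem linearMap_restrict_const_le (hp : ∀ t, IsSublinear (p t)) {Λ : SimpleFunc T U →ₗ[ℝ] ℝ}
    (hΛ : ∀ g, Λ g ≤ ∫ t, p t (g t) ∂μ) (h : U) {B : Set T} (hB : MeasurableSet B) :
    Λ ((SimpleFunc.const T h).restrict B) ≤ ∫ t in B, p t h ∂μ := by
  refine (hΛ _).trans_eq ?_
  rw [← integral_indicator hB]
  congr 1 with t
  by_cases ht : t ∈ B <;> simp [SimpleFunc.restrict_apply _ hB, ht, (hp t).map_zero]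

theorem abs_linearMap_restrict_const_le [IsFiniteMeasure μ] (hp : ∀ t, IsSublinear (p t))
    (hpK : ∀ t h, p t h ≤ K * ‖h‖) {Λ : SimpleFunc T U →ₗ[ℝ] ℝ}
    (hΛ : ∀ g, Λ g ≤ ∫ t, p t (g t) ∂μ) (h : U) (B : Set T) :
    |Λ ((SimpleFunc.const T h).restrict B)| ≤ K * ‖h‖ * μ.real B := by
  by_cases hB : MeasurableSet B
  swap
  · rw [SimpleFunc.restrict_of_not_measurable hB, _root_.map_zero, abs_zero]
    positivity
  have hle : ∀ h', Λ ((SimpleFunc.const T h').restrict B) ≤ K * ‖h'‖ * μ.real B := fun h' => by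
    refine ((linearMap_restrict_const_le hp hΛ h' hB).trans (Real.le_norm_self _)).trans ?_
    exact norm_setIntegral_le_of_norm_le_const (measure_lt_top μ B)
      fun t _ => ((hp t).abs_le (hpK t) h' : ‖p t h'‖ ≤ _)
  have hneg : (SimpleFunc.const T (-h)).restrict B = -(SimpleFunc.const T h).restrict B := by
    ext t
    by_cases ht : t ∈ B <;> simp [SimpleFunc.restrict_apply _ hB, ht]
  have hle_neg := hle (-h)
  rw [hneg, map_neg, norm_neg] at hle_neg
  exact abs_le.2 ⟨by linarith, hle h⟩

theorem exists_density_of_linearMap_simpleFunc [IsFiniteMeasure μ] (hp : ∀ t, IsSublinear (p t))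
    (hpK : ∀ t h, p t h ≤ K * ‖h‖) {Λ : SimpleFunc T U →ₗ[ℝ] ℝ}
    (hΛ : ∀ g, Λ g ≤ ∫ t, p t (g t) ∂μ) (h : U) :
    ∃ y : T → ℝ, Measurable y ∧ Integrable y μ ∧ ∀ B, MeasurableSet B →
      ∫ t in B, y t ∂μ = Λ ((SimpleFunc.const T h).restrict B) := by
  refine exists_density_of_additive_of_abs_le (C := K * ‖h‖₊)
    (fun B => Λ ((SimpleFunc.const T h).restrict B))
    (abs_linearMap_restrict_const_le hp hpK hΛ h) (fun B B' hB hB' hdisj => ?_)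
    (fun B hB => by rw [SimpleFunc.restrict_of_not_measurable hB, _root_.map_zero])
  rw [← map_add]
  congr 1
  ext t
  simp only [SimpleFunc.coe_restrict _ hB, SimpleFunc.coe_restrict _ hB', SimpleFunc.coe_add,
    SimpleFunc.coe_restrict _ (hB.union hB'), Set.indicator_union_of_disjoint hdisj, Pi.add_apply]

end IntegralOfSublinear

section Selection

variable {T : Type*} [MeasurableSpace T] {μ : Measure T} {U : Type*} [NormedAddCommGroup U]
  [NormedSpace ℝ U]

theorem exists_density_family_of_le_integral [IsFiniteMeasure μ] {p : T → U → ℝ} {K : NNReal}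
    (hpm : ∀ h, Measurable fun t => p t h) (hp : ∀ t, IsSublinear (p t))
    (hpK : ∀ t h, p t h ≤ K * ‖h‖) (x' : U →ₗ[ℝ] ℝ) (hx' : ∀ h, x' h ≤ ∫ t, p t h ∂μ) :
    ∃ Y : U → T → ℝ, (∀ h, Measurable (Y h)) ∧ (∀ h, Integrable (Y h) μ) ∧
      (∀ h k, Y (h + k) =ᵐ[μ] Y h + Y k) ∧ (∀ h, ∀ᵐ t ∂μ, Y h t ≤ p t h) ∧
      ∀ h, x' h = ∫ t, Y h t ∂μ := by
  obtain ⟨Λ, hΛconst, hΛ⟩ := exists_linearMap_simpleFunc_of_le_integral hpm hp hpK x' hx'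
  choose Y hYmeas hYint hY using exists_density_of_linearMap_simpleFunc hp hpK hΛ
  refine ⟨Y, hYmeas, hYint, fun h k => ?_, fun h => ?_, fun h => ?_⟩
  · refine Integrable.ae_eq_of_forall_setIntegral_eq _ _ (hYint _) ((hYint h).add (hYint k))
      fun B hB _ => ?_
    simp only [Pi.add_apply]
    rw [integral_add (hYint h).integrableOn (hYint k).integrableOn, hY _ B hB, hY h B hB,
      hY k B hB, ← map_add]
    congr 1
    ext t
    by_cases ht : t ∈ B <;> simp [SimpleFunc.restrict_apply _ hB, ht]
  · exact ae_le_of_forall_setIntegral_le (hYint h)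
      (integrable_sublinear_simpleFunc hpm hp hpK (SimpleFunc.const T h))
      fun B hB _ => (hY h B hB).trans_le (linearMap_restrict_const_le hp hΛ h hB)
  · rw [← setIntegral_univ, hY h _ MeasurableSet.univ, SimpleFunc.restrict_univ, hΛconst]

theorem ae_abs_le_of_ae_add_of_ae_le {V : Type*} [SeminormedAddCommGroup V] {Y : V → T → ℝ}
    {K : NNReal} (hadd : ∀ h k, Y (h + k) =ᵐ[μ] Y h + Y k) (hle : ∀ h, ∀ᵐ t ∂μ, Y h t ≤ K * ‖h‖)
    (h : V) :
    ∀ᵐ t ∂μ, |Y h t| ≤ K * ‖h‖ := by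
  filter_upwards [hadd 0 0, hadd h (-h), hle h, hle (-h)] with t hzero hneg hleh hleneg
  rw [add_zero, Pi.add_apply] at hzero
  rw [add_neg_cancel, Pi.add_apply] at hneg
  rw [norm_neg] at hleneg
  exact abs_le.2 ⟨by linarith, hleh⟩

theorem exists_strongDual_eqOn_of_dense (D : Submodule ℤ U) (hD : Dense (D : Set U)) (a : U → ℝ)
    {K : ℝ} (hadd : ∀ d ∈ D, ∀ e ∈ D, a (d + e) = a d + a e) (hbd : ∀ d ∈ D, |a d| ≤ K * ‖d‖) :
    ∃ s : StrongDual ℝ U, ∀ d ∈ D, s d = a d := by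
  let aD : D →+ ℝ := AddMonoidHom.mk' (fun d => a d) fun d e => hadd d d.2 e e.2
  have hcont : Continuous aD := AddMonoidHomClass.continuous_of_bound aD K fun d => hbd d d.2
  have hrange : DenseRange D.subtypeL := hD.denseRange_val
  let ψ : U →L[ℤ] ℝ := ContinuousLinearMap.extend ⟨aD.toIntLinearMap, hcont⟩ D.subtypeL
  refine ⟨ψ.toLinearMap.toAddMonoidHom.toRealLinearMap ψ.continuous, fun d hd => ?_⟩
  exact ContinuousLinearMap.extend_eq _ hrange (isUniformInducing_val _) ⟨d, hd⟩

theorem exists_countable_dense_submodule (U : Type*) [AddCommGroup U] [TopologicalSpace U]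
    [TopologicalSpace.SeparableSpace U] :
    ∃ D : Submodule ℤ U, (D : Set U).Countable ∧ Dense (D : Set U) := by
  refine ⟨Submodule.span ℤ (Set.range (TopologicalSpace.denseSeq U)), ?_,
    (TopologicalSpace.denseRange_denseSeq U).mono Submodule.subset_span⟩
  rw [← Finsupp.range_linearCombination, LinearMap.coe_range]
  exact Set.countable_range _

variable [TopologicalSpace.SeparableSpace U]

theorem exists_strongDual_family_eqOn_of_ae {Y : U → T → ℝ} {K : NNReal}
    (hadd : ∀ h k, Y (h + k) =ᵐ[μ] Y h + Y k) (hbd : ∀ h, ∀ᵐ t ∂μ, |Y h t| ≤ K * ‖h‖) :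
    ∃ (D : Submodule ℤ U) (s : T → StrongDual ℝ U) (G : Set T), Dense (D : Set U) ∧
      MeasurableSet G ∧ G ∈ ae μ ∧ ∀ d ∈ D, ∀ t, s t d = G.indicator (Y d) t := by
  obtain ⟨D, hDc, hD⟩ := exists_countable_dense_submodule U
  have hgood : ∀ᵐ t ∂μ, (∀ d ∈ D, ∀ e ∈ D, Y (d + e) t = Y d t + Y e t) ∧
      ∀ d ∈ D, |Y d t| ≤ K * ‖d‖ :=
    ((ae_ball_iff hDc).2 fun d _ => (ae_ball_iff hDc).2 fun e _ => hadd d e).and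
      ((ae_ball_iff hDc).2 fun d _ => hbd d)
  obtain ⟨G, hG, hGmeas, hgoodG⟩ := hgood.exists_measurable_mem
  have hext : ∀ t, ∃ s : StrongDual ℝ U, ∀ d ∈ D, s d = G.indicator (Y d) t := fun t => by
    refine exists_strongDual_eqOn_of_dense D hD (fun d => G.indicator (Y d) t) (K := K) ?_ ?_ <;>
      by_cases ht : t ∈ G
    · simpa only [Set.indicator_of_mem ht] using (hgoodG t ht).1
    · simp [ht]
    · simpa only [Set.indicator_of_mem ht] using (hgoodG t ht).2
    · intro d _
      rw [Set.indicator_of_notMem ht, abs_zero]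
      positivity
  choose s hs using hext
  exact ⟨D, s, G, hD, hGmeas, hG, fun d hd t => hs t d hd⟩

theorem exists_strongDual_family_ae_eq {Y : U → T → ℝ} {K : NNReal} (hY : ∀ h, Measurable (Y h))
    (hadd : ∀ h k, Y (h + k) =ᵐ[μ] Y h + Y k) (hbd : ∀ h, ∀ᵐ t ∂μ, |Y h t| ≤ K * ‖h‖) :
    ∃ s : T → StrongDual ℝ U, (∀ h, Measurable fun t => s t h) ∧
      ∀ h, (fun t => s t h) =ᵐ[μ] Y h := by
  obtain ⟨D, s, G, hD, hGmeas, hG, hs⟩ := exists_strongDual_family_eqOn_of_ae hadd hbd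
  have happrox : ∀ h, ∃ d : ℕ → U, (∀ n, d n ∈ D) ∧ Tendsto d atTop (𝓝 h) := fun h =>
    mem_closure_iff_seq_limit.1 (hD h)
  have hlim : ∀ {h : U} {d : ℕ → U}, Tendsto d atTop (𝓝 h) → ∀ t,
      Tendsto (fun n => s t (d n)) atTop (𝓝 (s t h)) := fun hd t =>
    ((s t).continuous.tendsto _).comp hd
  refine ⟨s, fun h => ?_, fun h => ?_⟩
  · obtain ⟨d, hdD, hd⟩ := happrox h
    refine measurable_of_tendsto_metrizable (fun n => ?_) (tendsto_pi_nhds.2 (hlim hd))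
    simpa only [hs (d n) (hdD n)] using (hY (d n)).indicator hGmeas
  · obtain ⟨d, hdD, hd⟩ := happrox h
    filter_upwards [hG, ae_all_iff.2 fun n => hadd (d n - h) h,
      ae_all_iff.2 fun n => hbd (d n - h)] with t htG htadd htbd
    have hYlim : Tendsto (fun n => Y (d n) t) atTop (𝓝 (Y h t)) := by
      refine tendsto_iff_norm_sub_tendsto_zero.2 (squeeze_zero (fun n => norm_nonneg _)
        (g := fun n => K * ‖d n - h‖) (fun n => ?_) ?_)
      · have hsub := htadd n
        rw [sub_add_cancel, Pi.add_apply] at hsub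
        rw [hsub, add_sub_cancel_right]
        exact htbd n
      · simpa using (tendsto_iff_norm_sub_tendsto_zero.1 hd).const_mul (K : ℝ)
    refine tendsto_nhds_unique (hlim hd t) (hYlim.congr fun n => ?_)
    rw [hs (d n) (hdD n), Set.indicator_of_mem htG]

theorem ae_forall_strongDual_le {s : T → StrongDual ℝ U} {p : T → U → ℝ}
    (hp : ∀ t, Continuous (p t)) (hle : ∀ h, ∀ᵐ t ∂μ, s t h ≤ p t h) :
    ∀ᵐ t ∂μ, ∀ h, s t h ≤ p t h := by
  filter_upwards [ae_all_iff.2 fun n => hle (TopologicalSpace.denseSeq U n)] with t ht h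
  exact (TopologicalSpace.denseRange_denseSeq U).induction_on h
    (isClosed_le (s t).continuous (hp t)) ht

/-- Strassen's disintegration theorem. -/
theorem exists_selection_of_le_integral [IsFiniteMeasure μ] {p : T → U → ℝ} {K : NNReal}
    (hpm : ∀ h, Measurable fun t => p t h) (hp : ∀ t, IsSublinear (p t))
    (hpK : ∀ t h, p t h ≤ K * ‖h‖) (x' : U →ₗ[ℝ] ℝ) (hx' : ∀ h, x' h ≤ ∫ t, p t h ∂μ) :
    ∃ s : T → StrongDual ℝ U, (∀ h, Measurable fun t => s t h) ∧
      (∀ᵐ t ∂μ, ∀ h, s t h ≤ p t h) ∧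
      ∀ h, Integrable (fun t => s t h) μ ∧ x' h = ∫ t, s t h ∂μ := by
  obtain ⟨Y, hYmeas, hYint, hYadd, hYle, hYx'⟩ :=
    exists_density_family_of_le_integral hpm hp hpK x' hx'
  have hYK : ∀ h, ∀ᵐ t ∂μ, Y h t ≤ K * ‖h‖ := fun h =>
    (hYle h).mono fun t ht => ht.trans (hpK t h)
  obtain ⟨s, hsmeas, hs⟩ :=
    exists_strongDual_family_ae_eq hYmeas hYadd (ae_abs_le_of_ae_add_of_ae_le hYadd hYK)
  refine ⟨s, hsmeas, ae_forall_strongDual_le (fun t => ((hp t).lipschitzWith (hpK t)).continuous)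
    fun h => ?_, fun h => ⟨(hYint h).congr (hs h).symm, ?_⟩⟩
  · filter_upwards [hs h, hYle h] with t hst hYt
    exact hst.trans_le hYt
  · rw [integral_congr_ae (hs h), hYx']

end Selection

theorem clarkeSubdifferential_integral_eq_aumannIntegral {T : Type*} [MeasurableSpace T]
    {μ : Measure T} [IsFiniteMeasure μ] {U : Type*} [NormedAddCommGroup U] [NormedSpace ℝ U]
    [TopologicalSpace.SeparableSpace U] {F : U → T → ℝ} (hFm : ∀ u, Measurable (F u))
    (hF : ∀ u, Integrable (F u) μ) {x : U} {K : NNReal} {N : Set U} (hN : N ∈ 𝓝 x)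
    (hLip : ∀ t, LipschitzOnWith K (fun u => F u t) N)
    (hreg : ∀ t h, ∃ p, HasClarkeLeftDeriv (fun u => F u t) x h p) :
    clarkeSubdifferential (fun u => ∫ t, F u t ∂μ) x =
      aumannIntegral μ fun t => clarkeSubdifferential (fun u => F u t) x := by
  choose p hp using hreg
  have hpsub : ∀ t, IsSublinear (p t) := fun t =>
    ⟨fun h k => (hp t h).le_add (hp t k) (hp t (h + k)),
      fun c hc h => (hp t h).smul_eq hc (hp t (c • h))⟩
  have hpK : ∀ t h, p t h ≤ K * ‖h‖ := fun t h => le_of_abs_le ((hp t h).abs_le hN (hLip t))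
  have hpm : ∀ h, Measurable fun t => p t h := fun h =>
    measurable_of_tendsto_metrizable' (𝓝[>] (0 : ℝ))
      (fun s => ((hFm x).sub (hFm (x - s • h))).div_const s)
      (tendsto_pi_nhds.2 fun t => (hp t h).tendsto)
  rw [HasClarkeLeftDeriv.clarkeSubdifferential_eq fun h =>
    HasClarkeLeftDeriv.integral hF hN hLip fun t => hp t h]
  simp only [fun t => HasClarkeLeftDeriv.clarkeSubdifferential_eq (hp t), aumannIntegral]
  ext x'
  refine ⟨exists_selection_of_le_integral hpm hpsub hpK x', ?_⟩
  rintro ⟨s, -, hsp, hs⟩ h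
  rw [(hs h).2]
  exact integral_mono_ae (hs h).1
    (HasClarkeLeftDeriv.integrable hF hN hLip fun t => hp t h) (hsp.mono fun t ht => ht h)

theorem lipschitzOnWith_integral {T : Type*} [MeasurableSpace T] {μ : Measure T}
    [IsProbabilityMeasure μ] {X : Type*} [PseudoMetricSpace X] {F : X → T → ℝ}
    (hF : ∀ u, Integrable (F u) μ) {K : NNReal} {N : Set X}
    (hLip : ∀ t, LipschitzOnWith K (fun u => F u t) N) :
    LipschitzOnWith K (fun u => ∫ t, F u t ∂μ) N := by
  refine LipschitzOnWith.of_le_add_mul K fun u hu u' hu' => ?_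
  rw [← sub_le_iff_le_add', ← integral_sub (hF u) (hF u')]
  calc ∫ t, (F u t - F u' t) ∂μ ≤ ∫ _, K * dist u u' ∂μ :=
        integral_mono ((hF u).sub (hF u')) (integrable_const _) fun t =>
          sub_le_iff_le_add'.2 ((hLip t).le_add_mul hu hu')
    _ = K * dist u u' := by simp

section Gaussian

open scoped RealInnerProductSpace

variable {E : Type*} [NormedAddCommGroup E] [InnerProductSpace ℝ E] [FiniteDimensional ℝ E]
  [MeasurableSpace E] [BorelSpace E]

theorem integrable_exp_neg_norm_sq_div_two :
    Integrable fun x : E => Real.exp (-‖x‖ ^ 2 / 2) := by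
  refine (GaussianFourier.integrable_cexp_neg_mul_sq_norm_add (b := 1 / 2) (V := E)
    (by norm_num) 0 0).norm.congr (Eventually.of_forall fun x => ?_)
  simp only [Complex.norm_exp]
  congr 1
  simp [← Complex.ofReal_pow]
  ring

theorem integral_exp_neg_norm_sq_div_two_mul_cexp_inner (t : E) :
    ∫ x : E, (Real.exp (-‖x‖ ^ 2 / 2) : ℂ) * Complex.exp (⟪x, t⟫ * Complex.I) =
      ((2 * Real.pi) ^ ((Module.finrank ℝ E : ℝ) / 2) : ℝ) * Complex.exp (-‖t‖ ^ 2 / 2) := by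
  have hexp : ∀ x : E,
      (Real.exp (-‖x‖ ^ 2 / 2) : ℂ) * Complex.exp (⟪x, t⟫ * Complex.I) =
        Complex.exp (-(1 / 2 : ℂ) * ‖x‖ ^ 2 + Complex.I * ⟪t, x⟫) := by
    intro x
    rw [Complex.exp_add, real_inner_comm, mul_comm Complex.I]
    push_cast
    ring_nf
  have hconst : ((Real.pi : ℂ) / (1 / 2)) ^ ((Module.finrank ℝ E : ℂ) / 2) =
      ((2 * Real.pi) ^ ((Module.finrank ℝ E : ℝ) / 2) : ℝ) := by
    rw [Complex.ofReal_cpow (by positivity)]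
    push_cast
    congr 1
    ring
  simp_rw [hexp]
  rw [GaussianFourier.integral_cexp_neg_mul_sq_norm_add (by norm_num), hconst, Complex.I_sq]
  congr 2
  ring

theorem stdGaussian_eq_withDensity :
    stdGaussian E = (volume : Measure E).withDensity fun x => ENNReal.ofReal
      ((2 * Real.pi) ^ (-(Module.finrank ℝ E : ℝ) / 2) * Real.exp (-‖x‖ ^ 2 / 2)) := by
  have : IsFiniteMeasure ((volume : Measure E).withDensity fun x => ENNReal.ofReal
      ((2 * Real.pi) ^ (-(Module.finrank ℝ E : ℝ) / 2) * Real.exp (-‖x‖ ^ 2 / 2))) :=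
    isFiniteMeasure_withDensity_ofReal (integrable_exp_neg_norm_sq_div_two.const_mul _).2
  refine Measure.ext_of_charFun (funext fun t => ?_)
  rw [charFun_stdGaussian, charFun_apply,
    integral_withDensity_eq_integral_toReal_smul (by fun_prop) (by simp)]
  have hsmul : ∀ x : E, (ENNReal.ofReal ((2 * Real.pi) ^ (-(Module.finrank ℝ E : ℝ) / 2) *
      Real.exp (-‖x‖ ^ 2 / 2))).toReal • Complex.exp (⟪x, t⟫ * Complex.I) =
      ((2 * Real.pi) ^ (-(Module.finrank ℝ E : ℝ) / 2) : ℝ) *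
        ((Real.exp (-‖x‖ ^ 2 / 2) : ℂ) * Complex.exp (⟪x, t⟫ * Complex.I)) := by
    intro x
    rw [ENNReal.toReal_ofReal (by positivity), Complex.real_smul, Complex.ofReal_mul, mul_assoc]
  have hconst : (2 * Real.pi) ^ (-(Module.finrank ℝ E : ℝ) / 2) *
      (2 * Real.pi) ^ ((Module.finrank ℝ E : ℝ) / 2) = 1 := by
    rw [← Real.rpow_add (by positivity), neg_div, neg_add_cancel, Real.rpow_zero]
  simp_rw [hsmul]
  rw [integral_const_mul, integral_exp_neg_norm_sq_div_two_mul_cexp_inner, ← mul_assoc,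
    ← Complex.ofReal_mul, hconst, Complex.ofReal_one, one_mul]

end Gaussian

theorem multivariateGaussian_mul_transpose {ι : Type*} [Fintype ι] [DecidableEq ι]
    (A : Matrix ι ι ℝ) :
    multivariateGaussian 0 (A * A.transpose) =
      (stdGaussian (EuclideanSpace ℝ ι)).map (Matrix.toEuclideanCLM (𝕜 := ℝ) A) := by
  have hpos : (A * A.transpose).PosSemidef := by
    simpa using Matrix.posSemidef_self_mul_conjTranspose A
  refine Measure.ext_of_charFun (funext fun t => ?_)
  set L := Matrix.toEuclideanCLM (𝕜 := ℝ) A with hL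
  have hadj : ‖ContinuousLinearMap.adjoint L t‖ ^ 2 = t ⬝ᵥ (A * A.transpose).mulVec t := by
    rw [← real_inner_self_eq_norm_sq, ContinuousLinearMap.adjoint_inner_left,
      ← ContinuousLinearMap.star_eq_adjoint, hL, ← map_star, ← mul_apply_eq_comp,
      ← map_mul, Matrix.inner_toEuclideanCLM, Matrix.star_eq_conjTranspose,
      Matrix.conjTranspose_eq_transpose_of_trivial]
  have hmap : charFun ((stdGaussian (EuclideanSpace ℝ ι)).map L) t =
      charFun (stdGaussian (EuclideanSpace ℝ ι)) (ContinuousLinearMap.adjoint L t) := by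
    rw [charFun_apply, charFun_apply, integral_map (by fun_prop) (by fun_prop)]
    simp only [ContinuousLinearMap.adjoint_inner_right]
  rw [charFun_multivariateGaussian hpos, hmap, charFun_stdGaussian, ← Complex.ofReal_pow, hadj]
  simp [neg_div]

theorem lintegral_eq_lintegral_toSphere {E : Type*} [NormedAddCommGroup E] [NormedSpace ℝ E]
    [FiniteDimensional ℝ E] [Nontrivial E] [MeasurableSpace E] [BorelSpace E] (μ : Measure E)
    [μ.IsAddHaarMeasure] {f : E → ENNReal} (hf : Measurable f) :
    ∫⁻ x, f x ∂μ = ∫⁻ v : Metric.sphere (0 : E) 1, (∫⁻ r in Set.Ioi (0 : ℝ),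
      ENNReal.ofReal (r ^ (Module.finrank ℝ E - 1)) * f (r • (v : E))) ∂μ.toSphere := by
  calc ∫⁻ x, f x ∂μ = ∫⁻ x in ({0}ᶜ : Set E), f x ∂μ := by simp
    _ = ∫⁻ x : ({0}ᶜ : Set E), f x ∂(μ.comap Subtype.val) := by
      rw [lintegral_subtype_comap (measurableSet_singleton _).compl]
    _ = ∫⁻ p : Metric.sphere (0 : E) 1 × Set.Ioi (0 : ℝ), f ((p.2 : ℝ) • (p.1 : E))
        ∂(μ.toSphere.prod (Measure.volumeIoiPow (Module.finrank ℝ E - 1))) := by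
      rw [← μ.measurePreserving_homeomorphUnitSphereProd.lintegral_comp_emb
        (Homeomorph.measurableEmbedding _)]
      refine lintegral_congr fun x => ?_
      have hx : ‖(x : E)‖ ≠ 0 := norm_ne_zero_iff.2 x.2
      simp [smul_smul, hx]
    _ = _ := by
      rw [lintegral_prod _ (by fun_prop)]
      refine lintegral_congr fun v => ?_
      have hfv : Measurable fun r : ℝ => f (r • (v : E)) := hf.comp (by fun_prop)
      rw [Measure.volumeIoiPow]
      refine (lintegral_withDensity_eq_lintegral_mul _ (by fun_prop)
        (hfv.comp measurable_subtype_coe)).trans ?_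
      exact lintegral_subtype_comap measurableSet_Ioi
        fun r : ℝ => ENNReal.ofReal (r ^ (Module.finrank ℝ E - 1)) * f (r • (v : E))

section SphericRadial

variable {m : ℕ}

theorem toSphere_univ_mul_gaussianConst (hm : 0 < m) :
    (volume : Measure (EuclideanSpace ℝ (Fin m))).toSphere Set.univ *
      ENNReal.ofReal ((2 * Real.pi) ^ (-(m : ℝ) / 2)) =
    ENNReal.ofReal ((2 : ℝ) ^ (1 - (m : ℝ) / 2) / Real.Gamma ((m : ℝ) / 2)) := by
  have : Nonempty (Fin m) := ⟨⟨0, hm⟩⟩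
  have hm2 : (0 : ℝ) < m / 2 := by positivity
  have := Real.Gamma_pos_of_pos hm2
  have := Real.rpow_pos_of_pos Real.pi_pos ((m : ℝ) / 2)
  have hsqrt : √Real.pi ^ m = Real.pi ^ ((m : ℝ) / 2) := by
    rw [Real.sqrt_eq_rpow, ← Real.rpow_mul_natCast Real.pi_pos.le, one_div_mul_eq_div]
  rw [Measure.toSphere_apply_univ, EuclideanSpace.volume_ball, finrank_euclideanSpace_fin,
    ← ENNReal.ofReal_natCast]
  simp only [Fintype.card_fin, ENNReal.ofReal_one, one_pow, one_mul]
  rw [← ENNReal.ofReal_mul (by positivity), ← ENNReal.ofReal_mul (by positivity), hsqrt,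
    Real.Gamma_add_one hm2.ne', Real.mul_rpow two_pos.le Real.pi_pos.le, neg_div,
    Real.rpow_neg Real.pi_pos.le, Real.rpow_sub two_pos, Real.rpow_one, Real.rpow_neg two_pos.le]
  congr 1
  field_simp

theorem chiDensity_nonneg (hm : 0 < m) {r : ℝ} (hr : 0 ≤ r) : 0 ≤ chiDensity m r := by
  have := Real.Gamma_pos_of_pos (by positivity : (0 : ℝ) < m / 2)
  unfold chiDensity
  positivity

theorem continuous_chiDensity (m : ℕ) : Continuous (chiDensity m) := by
  unfold chiDensity
  fun_prop

theorem chiMeasure_apply (m : ℕ) {S : Set ℝ} (hS : MeasurableSet S) :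
    chiMeasure m S =
      ∫⁻ r in Set.Ioi (0 : ℝ), S.indicator (fun r => ENNReal.ofReal (chiDensity m r)) r := by
  rw [chiMeasure, withDensity_apply _ hS, ← lintegral_indicator hS]

theorem toSphere_univ_ne_zero (hm : 0 < m) :
    (volume : Measure (EuclideanSpace ℝ (Fin m))).toSphere Set.univ ≠ 0 := by
  have : Nonempty (Fin m) := ⟨⟨0, hm⟩⟩
  exact Measure.measure_univ_ne_zero.2 (Measure.toSphere_ne_zero _)

theorem pow_mul_gaussianDensity_eq (hm : 0 < m) (v : UnitSphere m) {r : ℝ} (hr : 0 < r) :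
    ENNReal.ofReal (r ^ (m - 1)) * ENNReal.ofReal ((2 * Real.pi) ^ (-(m : ℝ) / 2) *
        Real.exp (-‖r • (v : EuclideanSpace ℝ (Fin m))‖ ^ 2 / 2)) =
      ((volume : Measure (EuclideanSpace ℝ (Fin m))).toSphere Set.univ)⁻¹ *
        ENNReal.ofReal (chiDensity m r) := by
  have := Real.Gamma_pos_of_pos (by positivity : (0 : ℝ) < m / 2)
  rw [norm_smul, norm_eq_of_mem_sphere v, mul_one, Real.norm_eq_abs, sq_abs, chiDensity, mul_assoc,
    ENNReal.ofReal_mul (by positivity), ENNReal.ofReal_mul (by positivity),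
    ENNReal.ofReal_mul (by positivity), ← toSphere_univ_mul_gaussianConst hm, mul_assoc,
    ← mul_assoc (_)⁻¹, ENNReal.inv_mul_cancel (toSphere_univ_ne_zero hm) (measure_ne_top _ _),
    one_mul]
  ring

theorem stdGaussian_eq_lintegral_chiMeasure (hm : 0 < m)
    {S : Set (EuclideanSpace ℝ (Fin m))} (hS : MeasurableSet S) :
    stdGaussian (EuclideanSpace ℝ (Fin m)) S =
      ∫⁻ v, chiMeasure m {r : ℝ | 0 ≤ r ∧ r • (v : EuclideanSpace ℝ (Fin m)) ∈ S}
        ∂(uniformSphere m) := by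
  have : Nonempty (Fin m) := ⟨⟨0, hm⟩⟩
  have hinv := ENNReal.inv_ne_top.2 (toSphere_univ_ne_zero hm)
  rw [stdGaussian_eq_withDensity, withDensity_apply _ hS, ← lintegral_indicator hS,
    lintegral_eq_lintegral_toSphere _ ((by fun_prop : Measurable _).indicator hS),
    finrank_euclideanSpace_fin, uniformSphere, lintegral_smul_measure, smul_eq_mul,
    ← lintegral_const_mul' _ _ hinv]
  refine lintegral_congr fun v => ?_
  have hradii : MeasurableSet {r : ℝ | 0 ≤ r ∧ r • (v : EuclideanSpace ℝ (Fin m)) ∈ S} :=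
    measurableSet_Ici.inter (hS.preimage (by fun_prop))
  rw [chiMeasure_apply m hradii, ← lintegral_const_mul' _ _ hinv]
  refine setLIntegral_congr_fun measurableSet_Ioi fun r (hr : 0 < r) => ?_
  by_cases hrS : r • (v : EuclideanSpace ℝ (Fin m)) ∈ S
  · have hmem : r ∈ {r : ℝ | 0 ≤ r ∧ r • (v : EuclideanSpace ℝ (Fin m)) ∈ S} := ⟨hr.le, hrS⟩
    rw [Set.indicator_of_mem hrS, Set.indicator_of_mem hmem, pow_mul_gaussianDensity_eq hm v hr]
  · simp [hrS]

theorem isProbabilityMeasure_uniformSphere (hm : 0 < m) :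
    IsProbabilityMeasure (uniformSphere m) := by
  refine ⟨?_⟩
  rw [uniformSphere, Measure.smul_apply, smul_eq_mul,
    ENNReal.inv_mul_cancel (toSphere_univ_ne_zero hm) (measure_ne_top _ _)]

theorem chiMeasure_Iio_zero (m : ℕ) : chiMeasure m (Set.Iio 0) = 0 := by
  rw [chiMeasure_apply m measurableSet_Iio]
  refine setLIntegral_eq_zero measurableSet_Ioi fun r (hr : 0 < r) => ?_
  simp [hr.le]

theorem isProbabilityMeasure_chiMeasure (hm : 0 < m) : IsProbabilityMeasure (chiMeasure m) := by
  have := isProbabilityMeasure_uniformSphere hm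
  have hIci := stdGaussian_eq_lintegral_chiMeasure hm MeasurableSet.univ
  simp only [measure_univ, Set.mem_univ, and_true, lintegral_const, mul_one] at hIci
  refine ⟨?_⟩
  rw [← measure_add_measure_compl measurableSet_Iio, chiMeasure_Iio_zero, zero_add, Set.compl_Iio]
  exact hIci.symm

end SphericRadial

section Chi

variable {m : ℕ}

theorem pow_mul_chiDensity_le (hm : 0 < m) {c r : ℝ} (hc : 0 ≤ c) (hc1 : c ≤ 1)
    (hr : 0 ≤ r) : c ^ m * chiDensity m r ≤ c * chiDensity m (c * r) := by
  have := Real.Gamma_pos_of_pos (by positivity : (0 : ℝ) < m / 2)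
  have hexp : Real.exp (-r ^ 2 / 2) ≤ Real.exp (-(c * r) ^ 2 / 2) := by
    have hsq : (c * r) ^ 2 ≤ r ^ 2 :=
      pow_le_pow_left₀ (mul_nonneg hc hr) (mul_le_of_le_one_left hr hc1) 2
    rw [Real.exp_le_exp]
    linarith
  unfold chiDensity
  set C := (2 : ℝ) ^ (1 - (m : ℝ) / 2) / Real.Gamma ((m : ℝ) / 2)
  calc c ^ m * (C * r ^ (m - 1) * Real.exp (-r ^ 2 / 2))
      ≤ c ^ m * (C * r ^ (m - 1) * Real.exp (-(c * r) ^ 2 / 2)) := by gcongr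
    _ = c * (C * (c * r) ^ (m - 1) * Real.exp (-(c * r) ^ 2 / 2)) := by
      rw [← mul_pow_sub_one hm.ne' c, mul_pow]
      ring

theorem lintegral_comp_mul_left_Ioi {c : ℝ} (hc : 0 < c) {f : ℝ → ENNReal} (hf : Measurable f) :
    ENNReal.ofReal c * ∫⁻ r in Set.Ioi (0 : ℝ), f (c * r) = ∫⁻ r in Set.Ioi (0 : ℝ), f r := by
  have hpre : (c * ·) ⁻¹' Set.Ioi (0 : ℝ) = Set.Ioi 0 := by
    ext r
    simp [hc]
  conv_rhs => rw [← Real.smul_map_volume_mul_left hc.ne', abs_of_pos hc]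
  rw [Measure.restrict_smul, lintegral_smul_measure, smul_eq_mul,
    setLIntegral_map measurableSet_Ioi hf (by fun_prop), hpre]

theorem pow_mul_chiMeasure_le (hm : 0 < m) {c : ℝ} (hc : 0 < c) (hc1 : c ≤ 1)
    {S S' : Set ℝ} (hS : MeasurableSet S) (hS' : MeasurableSet S')
    (hSS' : ∀ r ∈ S, c * r ∈ S') :
    ENNReal.ofReal (c ^ m) * chiMeasure m S ≤ chiMeasure m S' := by
  have hmeas : Measurable (S'.indicator fun r => ENNReal.ofReal (chiDensity m r)) :=
    (continuous_chiDensity m).measurable.ennreal_ofReal.indicator hS'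
  rw [chiMeasure_apply m hS, chiMeasure_apply m hS', ← lintegral_comp_mul_left_Ioi hc hmeas,
    ← lintegral_const_mul' _ _ ENNReal.ofReal_ne_top,
    ← lintegral_const_mul' _ _ ENNReal.ofReal_ne_top]
  refine setLIntegral_mono' measurableSet_Ioi fun r (hr : 0 < r) => ?_
  by_cases hrS : r ∈ S
  · rw [Set.indicator_of_mem hrS, Set.indicator_of_mem (hSS' r hrS),
      ← ENNReal.ofReal_mul (by positivity), ← ENNReal.ofReal_mul hc.le]
    exact ENNReal.ofReal_le_ofReal (pow_mul_chiDensity_le hm hc.le hc1 hr.le)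
  · simp [hrS]

theorem chiMeasure_real_Icc (hm : 0 < m) {b : ℝ} (hb : 0 ≤ b) :
    (chiMeasure m).real (Set.Icc 0 b) = ∫ r in (0 : ℝ)..b, chiDensity m r := by
  have hIcc : Set.Icc 0 b ∩ Set.Ioi 0 = Set.Ioc 0 b := by grind
  rw [intervalIntegral.integral_of_le hb, measureReal_def, chiMeasure,
    withDensity_apply _ measurableSet_Icc, Measure.restrict_restrict measurableSet_Icc, hIcc,
    integral_eq_lintegral_of_nonneg_ae _ (continuous_chiDensity m).aestronglyMeasurable]
  filter_upwards [ae_restrict_mem measurableSet_Ioc] with r hr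
  exact chiDensity_nonneg hm hr.1.le

theorem hasStrictDerivAt_integral_chiDensity (m : ℕ) (b : ℝ) :
    HasStrictDerivAt (fun b => ∫ r in (0 : ℝ)..b, chiDensity m r) (chiDensity m b) b :=
  intervalIntegral.integral_hasStrictDerivAt_right
    ((continuous_chiDensity m).intervalIntegrable _ _)
    ((continuous_chiDensity m).stronglyMeasurableAtFilter _ _)
    (continuous_chiDensity m).continuousAt

end Chi

theorem exists_pos_eventually_forall_closedBall {X : Type*} [PseudoMetricSpace X] {x : X}
    {p : X → Prop} (hp : ∀ᶠ y in 𝓝 x, p y) :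
    ∃ ε > 0, ∀ᶠ y in 𝓝 x, ∀ z ∈ Metric.closedBall y ε, p z := by
  obtain ⟨δ, hδ, hball⟩ := Metric.eventually_nhds_iff_ball.1 hp
  refine ⟨δ / 2, half_pos hδ, ?_⟩
  filter_upwards [Metric.ball_mem_nhds x (half_pos hδ)] with y hy z hz
  rw [Metric.mem_ball] at hy
  rw [Metric.mem_closedBall] at hz
  exact hball z (Metric.mem_ball.2 (by linarith [dist_triangle z y x]))

theorem one_sub_div_add_pow_le {ε d : ℝ} (hε : 0 < ε) (hd : 0 ≤ d) (n : ℕ) :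
    1 - (ε / (ε + d)) ^ n ≤ n / ε * d := by
  have hsum : 0 < ε + d := by positivity
  have hratio : 1 + -(d / (ε + d)) = ε / (ε + d) := by field_simp; ring
  have hle : d / (ε + d) ≤ 1 := (div_le_one hsum).2 (by linarith)
  have hbernoulli := one_add_mul_le_pow (a := -(d / (ε + d))) (by linarith) n
  rw [hratio] at hbernoulli
  calc 1 - (ε / (ε + d)) ^ n ≤ n * (d / (ε + d)) := by linarith
    _ ≤ n * (d / ε) := by gcongr; linarith
    _ = n / ε * d := by ring

/-- The radii at which the ray in direction `w` meets the feasible set `{z | g u z ≤ 0}`; the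
radial probability function is their chi measure. -/
def admissibleRadii {U E : Type*} [AddCommGroup E] [Module ℝ E] (g : U → E → ℝ) (w : E) (u : U) :
    Set ℝ :=
  {r | 0 ≤ r ∧ g u (r • w) ≤ 0}

section AdmissibleRadii

variable {U E : Type*} [NormedAddCommGroup E] [NormedSpace ℝ E] {g : U → E → ℝ} {w : E}
  {u u' u₀ : U} {r r' R a b ε : ℝ}

theorem zero_mem_admissibleRadii (h0 : g u 0 ≤ 0) : (0 : ℝ) ∈ admissibleRadii g w u :=
  ⟨le_rfl, by rwa [zero_smul]⟩

theorem isClosed_admissibleRadii (hgu : Continuous (g u)) (w : E) :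
    IsClosed (admissibleRadii g w u) :=
  isClosed_Ici.inter (isClosed_le (by fun_prop : Continuous fun r : ℝ => g u (r • w))
    continuous_const)

variable [NormedAddCommGroup U] [NormedSpace ℝ U]

theorem convexComb_mem_admissibleRadii (hg : ConvexOn ℝ Set.univ fun p : U × E => g p.1 p.2)
    (hr : r ∈ admissibleRadii g w u) (hr' : r' ∈ admissibleRadii g w u')
    (ha : 0 ≤ a) (hb : 0 ≤ b) (hab : a + b = 1) :
    a * r + b * r' ∈ admissibleRadii g w (a • u + b • u') := by
  refine ⟨add_nonneg (mul_nonneg ha hr.1) (mul_nonneg hb hr'.1), ?_⟩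
  have hconv := hg.2 (Set.mem_univ (u, r • w)) (Set.mem_univ (u', r' • w)) ha hb hab
  simp only [Prod.smul_mk, Prod.mk_add_mk, smul_smul, ← add_smul, smul_eq_mul] at hconv
  exact hconv.trans (add_nonpos (mul_nonpos_of_nonneg_of_nonpos ha hr.2)
    (mul_nonpos_of_nonneg_of_nonpos hb hr'.2))

theorem convex_admissibleRadii (hg : ConvexOn ℝ Set.univ fun p : U × E => g p.1 p.2) (w : E)
    (u : U) : Convex ℝ (admissibleRadii g w u) := fun r hr r' hr' a b ha hb hab => by
  simpa [Convex.combo_self hab] using convexComb_mem_admissibleRadii hg hr hr' ha hb hab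

theorem mul_mem_admissibleRadii (hg : ConvexOn ℝ Set.univ fun p : U × E => g p.1 p.2)
    (hε : 0 < ε) (h0 : ∀ v ∈ Metric.closedBall u' ε, g v 0 ≤ 0)
    (hr : r ∈ admissibleRadii g w u) :
    ε / (ε + dist u u') * r ∈ admissibleRadii g w u' := by
  rcases eq_or_ne u u' with rfl | hne
  · simpa [hε.ne'] using hr
  set d := dist u u' with hd
  have hd0 : 0 < d := dist_pos.2 hne
  have hab : ε / (ε + d) + d / (ε + d) = 1 := by field_simp
  -- `u'` lies between `u` and this point on the boundary of the ball of radius `ε` about `u'`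
  let v := u' + (ε / d) • (u' - u)
  have hv : v ∈ Metric.closedBall u' ε := by
    rw [mem_closedBall_iff_norm, add_sub_cancel_left, norm_smul, ← dist_eq_norm, dist_comm u' u,
      ← hd, Real.norm_of_nonneg (by positivity), div_mul_cancel₀ _ hd0.ne']
  have hcomb : (ε / (ε + d)) • u + (d / (ε + d)) • v = u' := by
    have hcoef : d / (ε + d) * (ε / d) = ε / (ε + d) := by field_simp
    calc (ε / (ε + d)) • u + (d / (ε + d)) • v
        = (ε / (ε + d) + d / (ε + d)) • u' := by
          simp only [v, smul_add, smul_smul, hcoef, smul_sub, add_smul]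
          abel
      _ = u' := by rw [hab, one_smul]
  have hmem := convexComb_mem_admissibleRadii hg hr (zero_mem_admissibleRadii (w := w) (h0 v hv))
    (by positivity) (by positivity) hab
  rwa [hcomb, mul_zero, add_zero] at hmem

theorem eventually_admissibleRadii_eq_Ici
    (hg : ConvexOn ℝ Set.univ fun p : U × E => g p.1 p.2) (h0 : ∀ᶠ u in 𝓝 u₀, g u 0 ≤ 0)
    (hray : admissibleRadii g w u₀ = Set.Ici 0) :
    ∀ᶠ u in 𝓝 u₀, admissibleRadii g w u = Set.Ici 0 := by
  obtain ⟨ε, hε, hball⟩ := exists_pos_eventually_forall_closedBall h0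
  filter_upwards [hball] with u hu
  refine Set.Subset.antisymm (fun r hr => hr.1) fun r (hr : 0 ≤ r) => ?_
  have hmem : (ε + dist u₀ u) / ε * r ∈ admissibleRadii g w u₀ := by
    rw [hray]
    exact mul_nonneg (by positivity) hr
  have hscale := mul_mem_admissibleRadii hg hε hu hmem
  rwa [← mul_assoc, div_mul_div_cancel₀ (by positivity), div_self hε.ne', one_mul] at hscale

theorem lt_of_mem_admissibleRadii (hg : ConvexOn ℝ Set.univ fun p : U × E => g p.1 p.2)
    (h0 : g u 0 ≤ 0) (hR0 : 0 ≤ R) (hR : 0 < g u (R • w)) (hr : r ∈ admissibleRadii g w u) :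
    r < R := by
  by_contra! hle
  exact hR.not_ge ((convex_admissibleRadii hg w u).ordConnected.out
    (zero_mem_admissibleRadii h0) hr ⟨hR0, hle⟩).2

theorem sSup_mem_admissibleRadii (hgu : Continuous (g u))
    (hg : ConvexOn ℝ Set.univ fun p : U × E => g p.1 p.2)
    (h0 : g u 0 ≤ 0) (hR0 : 0 ≤ R) (hR : 0 < g u (R • w)) :
    sSup (admissibleRadii g w u) ∈ admissibleRadii g w u :=
  (isClosed_admissibleRadii hgu w).csSup_mem ⟨0, zero_mem_admissibleRadii h0⟩
    ⟨R, fun _ hr => (lt_of_mem_admissibleRadii hg h0 hR0 hR hr).le⟩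

theorem admissibleRadii_eq_Icc (hgu : Continuous (g u))
    (hg : ConvexOn ℝ Set.univ fun p : U × E => g p.1 p.2)
    (h0 : g u 0 ≤ 0) (hR0 : 0 ≤ R) (hR : 0 < g u (R • w)) :
    admissibleRadii g w u = Set.Icc 0 (sSup (admissibleRadii g w u)) := by
  refine Set.Subset.antisymm (fun r hr => ⟨hr.1, le_csSup
    ⟨R, fun _ hr => (lt_of_mem_admissibleRadii hg h0 hR0 hR hr).le⟩ hr⟩) ?_
  exact (convex_admissibleRadii hg w u).ordConnected.out (zero_mem_admissibleRadii h0)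
    (sSup_mem_admissibleRadii hgu hg h0 hR0 hR)

theorem concaveOn_sSup_admissibleRadii {S : Set U} (hS : Convex ℝ S)
    (hgc : ∀ u ∈ S, Continuous (g u)) (hg : ConvexOn ℝ Set.univ fun p : U × E => g p.1 p.2)
    (h0 : ∀ u ∈ S, g u 0 ≤ 0) (hR0 : 0 ≤ R) (hR : ∀ u ∈ S, 0 < g u (R • w)) :
    ConcaveOn ℝ S fun u => sSup (admissibleRadii g w u) := by
  have hsup : ∀ u ∈ S, sSup (admissibleRadii g w u) ∈ admissibleRadii g w u := fun u hu =>
    sSup_mem_admissibleRadii (hgc u hu) hg (h0 u hu) hR0 (hR u hu)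
  refine ⟨hS, fun u hu u' hu' a b ha hb hab => ?_⟩
  have hmem := hS hu hu' ha hb hab
  exact le_csSup
    ⟨R, fun _ hr => (lt_of_mem_admissibleRadii hg (h0 _ hmem) hR0 (hR _ hmem) hr).le⟩
    (convexComb_mem_admissibleRadii hg (hsup u hu) (hsup u' hu') ha hb hab)

theorem exists_hasClarkeLeftDeriv_chiMeasure_admissibleRadii_of_pos {m : ℕ} (hm : 0 < m)
    (hgc : Continuous fun p : U × E => g p.1 p.2)
    (hg : ConvexOn ℝ Set.univ fun p : U × E => g p.1 p.2) (h0 : g u₀ 0 < 0)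
    (hR0 : 0 ≤ R) (hR : 0 < g u₀ (R • w)) (h : U) :
    ∃ p, HasClarkeLeftDeriv (fun u => (chiMeasure m).real (admissibleRadii g w u)) u₀ h p := by
  have hgu : ∀ u, Continuous (g u) := fun u => hgc.comp (Continuous.prodMk_right u)
  have hgz : ∀ z, Continuous fun u => g u z := fun z => hgc.comp (Continuous.prodMk_left z)
  obtain ⟨δ, hδ, hball⟩ := Metric.eventually_nhds_iff_ball.1
    (((hgz 0).continuousAt.eventually (gt_mem_nhds h0)).and
      ((hgz (R • w)).continuousAt.eventually (lt_mem_nhds hR)))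
  let ρ : U → ℝ := fun u => sSup (admissibleRadii g w u)
  have hmem : ∀ u ∈ Metric.ball u₀ δ, ρ u ∈ admissibleRadii g w u := fun u hu =>
    sSup_mem_admissibleRadii (hgu u) hg (hball u hu).1.le hR0 (hball u hu).2
  have hconc : ConcaveOn ℝ (Metric.ball u₀ δ) ρ :=
    concaveOn_sSup_admissibleRadii (convex_ball u₀ δ) (fun u _ => hgu u) hg
      (fun u hu => (hball u hu).1.le) hR0 fun u hu => (hball u hu).2
  have hbound : ∀ u, dist u u₀ < δ → |ρ u| ≤ R := fun u hu => by
    rw [abs_of_nonneg (hmem u hu).1]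
    exact (lt_of_mem_admissibleRadii hg (hball u hu).1.le hR0 (hball u hu).2 (hmem u hu)).le
  obtain ⟨p, hp⟩ := exists_hasClarkeLeftDeriv_comp_of_concaveOn hδ hconc hbound
    (hasStrictDerivAt_integral_chiDensity m (ρ u₀))
    (chiDensity_nonneg hm (hmem u₀ (Metric.mem_ball_self hδ)).1) h
  refine ⟨p, hp.congr ?_⟩
  filter_upwards [Metric.ball_mem_nhds u₀ hδ] with u hu
  rw [admissibleRadii_eq_Icc (hgu u) hg (hball u hu).1.le hR0 (hball u hu).2,
    chiMeasure_real_Icc hm (hmem u hu).1]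

theorem exists_hasClarkeLeftDeriv_chiMeasure_admissibleRadii {m : ℕ} (hm : 0 < m)
    (hgc : Continuous fun p : U × E => g p.1 p.2)
    (hg : ConvexOn ℝ Set.univ fun p : U × E => g p.1 p.2) (h0 : g u₀ 0 < 0) (w : E) (h : U) :
    ∃ p, HasClarkeLeftDeriv (fun u => (chiMeasure m).real (admissibleRadii g w u)) u₀ h p := by
  by_cases hray : ∀ r : ℝ, 0 ≤ r → g u₀ (r • w) ≤ 0
  · have hcont : Continuous fun u => g u 0 := hgc.comp (Continuous.prodMk_left 0)
    have hslater : ∀ᶠ u in 𝓝 u₀, g u 0 ≤ 0 :=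
      (hcont.continuousAt.eventually (gt_mem_nhds h0)).mono fun _ hu => hu.le
    refine ⟨0, (HasClarkeLeftDeriv.const ((chiMeasure m).real (Set.Ici 0))).congr ?_⟩
    filter_upwards [eventually_admissibleRadii_eq_Ici hg hslater
      (Set.ext fun r => ⟨fun hr => hr.1, fun hr => ⟨hr, hray r hr⟩⟩)] with u hu
    rw [hu]
  · push Not at hray
    obtain ⟨R, hR0, hR⟩ := hray
    exact exists_hasClarkeLeftDeriv_chiMeasure_admissibleRadii_of_pos hm hgc hg h0 hR0 hR h

theorem lipschitzOnWith_chiMeasure_admissibleRadii {m : ℕ} (hm : 0 < m) {S : Set U}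
    (hgc : ∀ u ∈ S, Continuous (g u)) (hg : ConvexOn ℝ Set.univ fun p : U × E => g p.1 p.2)
    (hε : 0 < ε) (h0 : ∀ u ∈ S, ∀ v ∈ Metric.closedBall u ε, g v 0 ≤ 0) (w : E) :
    LipschitzOnWith (m / ε).toNNReal (fun u => (chiMeasure m).real (admissibleRadii g w u)) S := by
  have := isProbabilityMeasure_chiMeasure hm
  refine LipschitzOnWith.of_le_add_mul _ fun u hu u' hu' => ?_
  rw [Real.coe_toNNReal _ (by positivity)]
  set c := ε / (ε + dist u u')
  have hc : 0 < c := by positivity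
  have hc1 : c ≤ 1 := (div_le_one (by positivity)).2 (le_add_of_nonneg_right dist_nonneg)
  have hscale : c ^ m * (chiMeasure m).real (admissibleRadii g w u) ≤
      (chiMeasure m).real (admissibleRadii g w u') := by
    have hle := ENNReal.toReal_mono (measure_ne_top _ _) (pow_mul_chiMeasure_le hm hc hc1
      (isClosed_admissibleRadii (hgc u hu) w).measurableSet
      (isClosed_admissibleRadii (hgc u' hu') w).measurableSet
      fun r => mul_mem_admissibleRadii hg hε (h0 u' hu'))
    rwa [ENNReal.toReal_mul, ENNReal.toReal_ofReal (by positivity)] at hle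
  have hdefect : (1 - c ^ m) * (chiMeasure m).real (admissibleRadii g w u) ≤
      m / ε * dist u u' :=
    (mul_le_of_le_one_right (sub_nonneg.2 (pow_le_one₀ hc.le hc1)) measureReal_le_one).trans
      (one_sub_div_add_pow_le hε dist_nonneg m)
  linarith

end AdmissibleRadii

section RadialProbability

variable {U : Type*} {m : ℕ} {A : Matrix (Fin m) (Fin m) ℝ}
  {g : U → EuclideanSpace ℝ (Fin m) → ℝ} {u : U}

theorem measurable_radialProbFun (hm : 0 < m) (A : Matrix (Fin m) (Fin m) ℝ)
    (hgu : Continuous (g u)) : Measurable (radialProbFun A g u) := by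
  have := isProbabilityMeasure_chiMeasure hm
  have hcont : Continuous fun q : UnitSphere m × ℝ =>
      g u (q.2 • Matrix.toEuclideanCLM (𝕜 := ℝ) A (q.1 : EuclideanSpace ℝ (Fin m))) := by
    fun_prop
  have hclosed : IsClosed {q : UnitSphere m × ℝ | 0 ≤ q.2 ∧
      g u (q.2 • Matrix.toEuclideanCLM (𝕜 := ℝ) A (q.1 : EuclideanSpace ℝ (Fin m))) ≤ 0} :=
    (isClosed_le continuous_const continuous_snd).inter (isClosed_le hcont continuous_const)
  exact (measurable_measure_prodMk_left hclosed.measurableSet).ennreal_toReal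

theorem integrable_radialProbFun (hm : 0 < m) (A : Matrix (Fin m) (Fin m) ℝ)
    (hgu : Continuous (g u)) : Integrable (radialProbFun A g u) (uniformSphere m) := by
  have := isProbabilityMeasure_chiMeasure hm
  have := isProbabilityMeasure_uniformSphere hm
  refine Integrable.of_bound (measurable_radialProbFun hm A hgu).aestronglyMeasurable 1
    (Eventually.of_forall fun v => ?_)
  rw [radialProbFun, Real.norm_of_nonneg measureReal_nonneg]
  exact measureReal_le_one

theorem probFun_eq_integral_radialProbFun {Ω : Type*} [MeasurableSpace Ω] {P : Measure Ω}
    (hm : 0 < m) {ξ : Ω → EuclideanSpace ℝ (Fin m)}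
    (hξ : HasLaw ξ (multivariateGaussian 0 (A * A.transpose)) P) (hgu : Continuous (g u)) :
    probFun P ξ g u = ∫ v, radialProbFun A g u v ∂(uniformSphere m) := by
  have := isProbabilityMeasure_chiMeasure hm
  have hnonneg : ∀ v, 0 ≤ radialProbFun A g u v := fun v => measureReal_nonneg
  let L := Matrix.toEuclideanCLM (𝕜 := ℝ) A
  have hfeas : MeasurableSet {z | g u z ≤ 0} :=
    (isClosed_le hgu continuous_const).measurableSet
  have hL : Measurable L := L.continuous.measurable
  have hdecomp : P {ω | g u (ξ ω) ≤ 0} =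
      ∫⁻ v, ENNReal.ofReal (radialProbFun A g u v) ∂(uniformSphere m) := by
    have hlaw := Measure.map_apply_of_aemeasurable hξ.aemeasurable hfeas
    rw [hξ.map_eq, multivariateGaussian_mul_transpose, Measure.map_apply hL hfeas,
      stdGaussian_eq_lintegral_chiMeasure hm (hL hfeas)] at hlaw
    refine hlaw.symm.trans (lintegral_congr fun v => ?_)
    rw [radialProbFun, ofReal_measureReal]
    simp only [Set.mem_preimage, map_smul]
    rfl
  rw [probFun, measureReal_def, hdecomp, integral_eq_lintegral_of_nonneg_ae
    (Eventually.of_forall hnonneg) (measurable_radialProbFun hm A hgu).aestronglyMeasurable]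

end RadialProbability

theorem theorem2p3_general
    {U : Type*} [NormedAddCommGroup U] [NormedSpace ℝ U] [TopologicalSpace.SeparableSpace U]
    {Ω : Type*} [MeasurableSpace Ω] (P : Measure Ω)
    (m : ℕ) (hm : 0 < m)
    (Sig A : Matrix (Fin m) (Fin m) ℝ) (hA : A * A.transpose = Sig)
    (ξ : Ω → EuclideanSpace ℝ (Fin m)) (hξ : HasLaw ξ (multivariateGaussian 0 Sig) P)
    (g : U → EuclideanSpace ℝ (Fin m) → ℝ)
    (hgCont : Continuous fun p : U × EuclideanSpace ℝ (Fin m) => g p.1 p.2)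
    (hgConv : ConvexOn ℝ Set.univ fun p : U × EuclideanSpace ℝ (Fin m) => g p.1 p.2)
    (u₀ : U) (hSlater : g u₀ 0 < 0) :
    (∃ K : NNReal, ∃ N ∈ 𝓝 u₀, LipschitzOnWith K (probFun P ξ g) N ∧
      ∀ v : UnitSphere m, LipschitzOnWith K (fun u => radialProbFun A g u v) N) ∧
    clarkeSubdifferential (probFun P ξ g) u₀ =
      aumannIntegral (uniformSphere m)
        (fun v => clarkeSubdifferential (fun u => radialProbFun A g u v) u₀) := by
  subst hA
  have := isProbabilityMeasure_uniformSphere hm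
  have hgu : ∀ u, Continuous (g u) := fun u => hgCont.comp (Continuous.prodMk_right u)
  have hg0 : Continuous fun u => g u 0 := hgCont.comp (Continuous.prodMk_left 0)
  obtain ⟨ε, hε, hN⟩ := exists_pos_eventually_forall_closedBall
    (hg0.continuousAt.eventually (gt_mem_nhds hSlater))
  have hint := fun u => integrable_radialProbFun hm A (hgu u)
  have hLip : ∀ v : UnitSphere m, LipschitzOnWith (m / ε).toNNReal
      (fun u => radialProbFun A g u v) {u | ∀ z ∈ Metric.closedBall u ε, g z 0 < 0} := fun v =>
    lipschitzOnWith_chiMeasure_admissibleRadii hm (fun u _ => hgu u) hgConv hε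
      (fun u hu z hz => (hu z hz).le) _
  have hreg : ∀ v h, ∃ p, HasClarkeLeftDeriv (fun u => radialProbFun A g u v) u₀ h p := fun v h =>
    exists_hasClarkeLeftDeriv_chiMeasure_admissibleRadii hm hgCont hgConv hSlater _ h
  have hφ : probFun P ξ g = fun u => ∫ v, radialProbFun A g u v ∂(uniformSphere m) :=
    funext fun u => probFun_eq_integral_radialProbFun hm hξ (hgu u)
  rw [hφ]
  exact ⟨⟨_, _, hN, lipschitzOnWith_integral hint hLip, hLip⟩,
    clarkeSubdifferential_integral_eq_aumannIntegral
      (fun u => measurable_radialProbFun hm A (hgu u)) hint hN hLip hreg⟩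

theorem theorem2p3
    {U : Type*} [NormedAddCommGroup U] [NormedSpace ℝ U] [CompleteSpace U]
    [TopologicalSpace.SeparableSpace U]
    (hrefl : Function.Surjective (NormedSpace.inclusionInDoubleDual ℝ U))
    {Ω : Type*} [MeasurableSpace Ω] (P : Measure Ω) [IsProbabilityMeasure P]
    (m : ℕ) (hm : 0 < m)
    (Sig A : Matrix (Fin m) (Fin m) ℝ) (hA : A * A.transpose = Sig)
    (ξ : Ω → EuclideanSpace ℝ (Fin m)) (hξ : HasLaw ξ (multivariateGaussian 0 Sig) P)
    (g : U → EuclideanSpace ℝ (Fin m) → ℝ)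
    (hgLip : LocallyLipschitz fun p : U × EuclideanSpace ℝ (Fin m) => g p.1 p.2)
    (hgConv : ConvexOn ℝ Set.univ fun p : U × EuclideanSpace ℝ (Fin m) => g p.1 p.2)
    (u₀ : U) (hSlater : g u₀ 0 < 0)
    (hM : Bornology.IsBounded {z : EuclideanSpace ℝ (Fin m) | g u₀ z ≤ 0}) :
    (∃ K : NNReal, ∃ N ∈ 𝓝 u₀, LipschitzOnWith K (probFun P ξ g) N ∧
      ∀ v : UnitSphere m, LipschitzOnWith K (fun u => radialProbFun A g u v) N) ∧
    clarkeSubdifferential (probFun P ξ g) u₀ =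
      aumannIntegral (uniformSphere m)
        (fun v => clarkeSubdifferential (fun u => radialProbFun A g u v) u₀) :=
  theorem2p3_general P m hm Sig A hA ξ hξ g hgLip.continuous hgConv u₀ hSlater
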